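/- Let $R$ be a (left) Noetherian ring and let $V$ be a finitely generated FI-module over $R$. Here an FI-module over $R$ is a functor from the category FI of finite sets and injections to the category of (left) $R$-modules; write $V_n = V(\{1,\dots,n\})$, with the $S_n$-action induced by functoriality. $V$ is finitely generated if there is a finite set of elements of $\coprod_{i\ge 0} V_i$ that is contained in no proper sub-FI-module of $V$. Then there exists an integer $N \ge 0$ such that for every $n \ge 0$ there is an isomorphism of $S_n$-representations over $R$ $$\varinjlim_{S} V(S) \;\cong\; V_n,$$ where the colimit is taken over the poset, ordered by inclusion, of the subsets $S \subseteq \{1,\dots,n\}$ with $|S| \le N$, and $\sigma \in S_n$ acts on the colimit through the maps $V(S) \to V(\sigma(S))$ induced by the bijections $\sigma|_S : S \to \sigma(S)$. The isomorphism can be taken to be the natural map, induced by the inclusions $S \hookrightarrow \{1,\dots,n\}$. -/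

import Mathlib

open CategoryTheory CategoryTheory.Limits

universe u v

/-- An object of the category FI: a finite set. -/
structure FI : Type 1 where
  /-- The underlying set. -/
  carrier : Type
  [finite : Finite carrier]

namespace FI

attribute [instance] FI.finite

/-- The morphisms of FI are the injections. -/
instance : Category FI where
  Hom X Y := X.carrier ↪ Y.carrier
  id X := Function.Embedding.refl X.carrier
  comp f g := Function.Embedding.trans f g

/-- The set `{1, …, n}`, as an object of FI. -/
abbrev std (n : ℕ) : FI := ⟨Fin n⟩

/-- A permutation, as a morphism of FI. -/
def ofPerm {n : ℕ} (σ : Equiv.Perm (Fin n)) : std n ⟶ std n := σ.toEmbedding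

/-- A finite subset of `{1, …, n}`, as an object of FI. -/
abbrev ofFinset {n : ℕ} (S : Finset (Fin n)) : FI := ⟨{a : Fin n // a ∈ S}⟩

/-- The inclusion of a subset `S` into `{1, …, n}`. -/
def incl {n : ℕ} (S : Finset (Fin n)) : ofFinset S ⟶ std n := Function.Embedding.subtype _

/-- The injection `S → T` obtained by restricting a permutation `σ` with `σ(S) ⊆ T`. -/
def restrict {n : ℕ} (σ : Equiv.Perm (Fin n)) {S T : Finset (Fin n)}
    (h : ∀ a ∈ S, σ a ∈ T) : ofFinset S ⟶ ofFinset T :=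
  (⟨fun a => ⟨σ a.1, h a.1 a.2⟩, fun _ _ hab =>
    Subtype.ext (σ.injective (congrArg Subtype.val hab))⟩ :
    {a : Fin n // a ∈ S} ↪ {a : Fin n // a ∈ T})

/-- The inclusion `S → T` of finite subsets of `{1, …, n}`. -/
def inclusion {n : ℕ} {S T : Finset (Fin n)} (h : S ⊆ T) : ofFinset S ⟶ ofFinset T :=
  Subtype.impEmbedding _ _ fun _ ha => h ha

end FI

/-- The poset of subsets `S ⊆ {1, …, n}` with `|S| ≤ N`, ordered by inclusion. -/
abbrev SmallSubset (n N : ℕ) : Type := {S : Finset (Fin n) // S.card ≤ N}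

namespace SmallSubset

/-- The tautological functor from the poset of subsets with at most `N` elements to FI. -/
def toFI (n N : ℕ) : SmallSubset n N ⥤ FI where
  obj S := FI.ofFinset S.1
  map f := FI.inclusion (leOfHom f)

/-- The image `σ(S)` of a subset with at most `N` elements. -/
def image {n N : ℕ} (σ : Equiv.Perm (Fin n)) (S : SmallSubset n N) : SmallSubset n N :=
  ⟨S.1.map σ.toEmbedding, by rw [Finset.card_map]; exact S.2⟩

theorem mem_image {n N : ℕ} (σ : Equiv.Perm (Fin n)) (S : SmallSubset n N) :
    ∀ a ∈ S.1, σ a ∈ (image σ S).1 :=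
  fun _ ha => Finset.mem_map_of_mem σ.toEmbedding ha

theorem image_le {n N : ℕ} {σ : Equiv.Perm (Fin n)} {S T : SmallSubset n N}
    (h : ∀ a ∈ S.1, σ a ∈ T.1) : image σ S ≤ T := by
  intro b hb
  obtain ⟨a, ha, rfl⟩ := Finset.mem_map.1 hb
  exact h a ha

end SmallSubset

/-- An FI-module over `R`: a functor from FI to the category of (left) `R`-modules. -/
abbrev FIModule (R : Type u) [Ring R] := FI ⥤ ModuleCat.{v} R

namespace FIModule

variable {R : Type u} [Ring R]

/-- A sub-FI-module of `V`: submodules of the modules `V(X)`, preserved by the maps of `V`. -/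
structure Sub (V : FIModule.{u, v} R) where
  /-- The submodule of `V(X)`. -/
  obj (X : FI) : Submodule R (V.obj X)
  map_mem {X Y : FI} (f : X ⟶ Y) (x : V.obj X) : x ∈ obj X → V.map f x ∈ obj Y

/-- `V` is finitely generated if there is a finite set of elements of `∐ i, V_i` that is
contained in no proper sub-FI-module of `V`. -/
def FinitelyGenerated (V : FIModule.{u, v} R) : Prop :=
  ∃ s : Set (Σ i : ℕ, V.obj (FI.std i)), s.Finite ∧
    ∀ W : Sub V, (∀ x ∈ s, x.2 ∈ W.obj (FI.std x.1)) → ∀ X : FI, W.obj X = ⊤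

/-- The action of the symmetric group `S_n` on `V_n`. -/
def perm (V : FIModule.{u, v} R) (n : ℕ) :
    Equiv.Perm (Fin n) →* Module.End R (V.obj (FI.std n)) where
  toFun σ := (V.map (FI.ofPerm σ)).hom
  map_one' := congrArg ModuleCat.Hom.hom (V.map_id (FI.std n))
  map_mul' σ τ := congrArg ModuleCat.Hom.hom (V.map_comp (FI.ofPerm τ) (FI.ofPerm σ))

/-- The diagram `S ↦ V(S)` on the poset of subsets `S ⊆ {1, …, n}` with `|S| ≤ N`. -/
abbrev diagram (V : FIModule.{u, v} R) (n N : ℕ) : SmallSubset n N ⥤ ModuleCat.{v} R :=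
  SmallSubset.toFI n N ⋙ V

/-- The colimit of the modules `V(S)` over the subsets `S ⊆ {1, …, n}` with `|S| ≤ N`. -/
noncomputable abbrev smallColimit (V : FIModule.{u, v} R) (n N : ℕ) : ModuleCat.{v} R :=
  colimit (V.diagram n N)

/-- The structure map `V(S) → colim V`. -/
noncomputable abbrev toColimit (V : FIModule.{u, v} R) {n N : ℕ} (S : SmallSubset n N) :
    V.obj (FI.ofFinset S.1) ⟶ V.smallColimit n N :=
  colimit.ι (V.diagram n N) S

theorem map_restrict_toColimit (V : FIModule.{u, v} R) {n N : ℕ} (σ : Equiv.Perm (Fin n))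
    {S T : SmallSubset n N} (h : ∀ a ∈ S.1, σ a ∈ T.1) :
    V.map (FI.restrict σ h) ≫ V.toColimit T =
      V.map (FI.restrict σ (SmallSubset.mem_image σ S)) ≫ V.toColimit (SmallSubset.image σ S) := by
  have hw : V.map (FI.inclusion (SmallSubset.image_le h)) ≫ V.toColimit T =
      V.toColimit (SmallSubset.image σ S) :=
    colimit.w (V.diagram n N) (homOfLE (SmallSubset.image_le h))
  rw [← hw, ← Category.assoc, ← V.map_comp]
  rfl

/-- The endomorphism of `colim V(S)` induced by a permutation `σ`: on `V(S)` it is the map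
`V(S) → V(σ(S))` induced by the bijection `σ : S → σ(S)`, followed by the structure map. -/
noncomputable def permColimitHom (V : FIModule.{u, v} R) (n N : ℕ) (σ : Equiv.Perm (Fin n)) :
    V.smallColimit n N ⟶ V.smallColimit n N :=
  colimit.desc (V.diagram n N)
    { pt := V.smallColimit n N
      ι :=
        { app := fun S =>
            V.map (FI.restrict σ (SmallSubset.mem_image σ S)) ≫
              V.toColimit (SmallSubset.image σ S)
          naturality := fun S T f => by
            have hST : ∀ a ∈ S.1, σ a ∈ (SmallSubset.image σ T).1 := fun a ha =>
              SmallSubset.mem_image σ T a (leOfHom f ha)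
            have h := V.map_restrict_toColimit σ hST
            have hr : FI.restrict σ hST =
                FI.inclusion (leOfHom f) ≫ FI.restrict σ (SmallSubset.mem_image σ T) := rfl
            rw [hr, V.map_comp, Category.assoc] at h
            exact h.trans (Category.comp_id _).symm } }

theorem toColimit_permColimitHom (V : FIModule.{u, v} R) {n N : ℕ} (σ : Equiv.Perm (Fin n))
    (S : SmallSubset n N) :
    V.toColimit S ≫ V.permColimitHom n N σ =
      V.map (FI.restrict σ (SmallSubset.mem_image σ S)) ≫
        V.toColimit (SmallSubset.image σ S) :=
  colimit.ι_desc _ S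

/-- The action of `S_n` on the colimit of the modules `V(S)`. -/
noncomputable def permColimit (V : FIModule.{u, v} R) (n N : ℕ) :
    Equiv.Perm (Fin n) →* Module.End R (V.smallColimit n N) where
  toFun σ := (V.permColimitHom n N σ).hom
  map_one' := by
    have h : V.permColimitHom n N 1 = 𝟙 _ := by
      refine colimit.hom_ext fun S => ?_
      change V.toColimit S ≫ V.permColimitHom n N 1 = V.toColimit S ≫ 𝟙 _
      rw [V.toColimit_permColimitHom, ← V.map_restrict_toColimit 1 (S := S) (T := S)
        (fun a ha => ha), Category.comp_id]
      exact (congrArg (· ≫ V.toColimit S) (V.map_id _)).trans (Category.id_comp _)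
    exact congrArg ModuleCat.Hom.hom h
  map_mul' σ τ := by
    have h : V.permColimitHom n N (σ * τ) =
        V.permColimitHom n N τ ≫ V.permColimitHom n N σ := by
      refine colimit.hom_ext fun S => ?_
      change V.toColimit S ≫ V.permColimitHom n N (σ * τ) =
        V.toColimit S ≫ V.permColimitHom n N τ ≫ V.permColimitHom n N σ
      rw [V.toColimit_permColimitHom, ← Category.assoc, V.toColimit_permColimitHom,
        Category.assoc, V.toColimit_permColimitHom, ← Category.assoc, ← V.map_comp,
        ← V.map_restrict_toColimit (σ * τ) (S := S)
          (T := SmallSubset.image σ (SmallSubset.image τ S))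
          (fun a ha => SmallSubset.mem_image σ _ _ (SmallSubset.mem_image τ S a ha))]
      rfl
    exact congrArg ModuleCat.Hom.hom h

end FIModule

/-! A Gröbner basis argument bounds the relations of `V`, and bounded relations determine the
colimit. Let F be a free FI-module on finitely many elements, mapping onto `V` by `cover`. Order
each basis of F lexicographically; increasing injections preserve this order, and Higman's lemma
makes divisibility along them a well-quasi-order. With the ascending chain condition on left ideals
of leading coefficients, it follows that the kernel is generated in degrees at most some N₀
(`exists_generated_le`). Take N at least N₀ and the degrees of the generators. The cover of `V_n`
then lifts to a surjection from F_n to the colimit (`colimitCover`). A generating relation already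
holds in some `V(S)` with |S| ≤ N₀, so the lift kills the whole kernel of the cover
(`ker_cover_le_ker_colimitCover`). Hence the natural map is injective; it is onto because the cover
is. -/

/-- Higman's lemma over a finite alphabet. -/
theorem List.wellQuasiOrdered_sublist (α : Type*) [Finite α] :
    WellQuasiOrdered (List.Sublist : List α → List α → Prop) := by
  have h : (Set.univ : Set α).PartiallyWellOrderedOn (· = ·) :=
    fun f => Finite.wellQuasiOrdered (Subrel (· = ·) (· ∈ (Set.univ : Set α))) f
  have h2 := Set.PartiallyWellOrderedOn.partiallyWellOrderedOn_sublistForall₂ (· = ·) h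
  intro f
  obtain ⟨a, b, hab, hs⟩ := h2 fun n => ⟨f n, fun _ _ => Set.mem_univ _⟩
  refine ⟨a, b, hab, ?_⟩
  obtain ⟨l, hl, hl'⟩ := List.sublistForall₂_iff.1 hs
  rw [List.forall₂_eq_eq_eq] at hl
  subst hl
  exact hl'

/-! ### Bases of free FI-modules: lexicographic order and divisibility -/

/-- The standard basis, at a set `A`, of the free FI-module with generators in the degrees
`m i`. -/
abbrev FreeBasis {ι : Type} (m : ι → ℕ) (A : Type) : Type := Σ i : ι, Fin (m i) ↪ A

namespace FreeBasis

variable {ι : Type} {m : ι → ℕ}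

/-- The map of standard bases induced by an injection. -/
def map {A B : Type} (f : A ↪ B) (x : FreeBasis m A) : FreeBasis m B := ⟨x.1, x.2.trans f⟩

theorem map_injective {A B : Type} (f : A ↪ B) :
    Function.Injective (map f : FreeBasis m A → FreeBasis m B) := by
  rintro ⟨i, x⟩ ⟨j, y⟩ h
  obtain rfl : i = j := congrArg Sigma.fst h
  have h2 : x.trans f = y.trans f := eq_of_heq (Sigma.mk.inj h).2
  congr 1
  ext a
  exact f.injective (DFunLike.congr_fun h2 a)

/-- A basis element, as an element of a lexicographic order. -/
def toLexSigma {A : Type} (x : FreeBasis m A) : Σₗ i : ι, Lex (Fin (m i) → A) :=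
  toLex ⟨x.1, toLex x.2⟩

theorem toLexSigma_injective {A : Type} :
    Function.Injective (toLexSigma : FreeBasis m A → _) := by
  rintro ⟨i, x⟩ ⟨j, y⟩ h
  obtain rfl : i = j := congrArg Sigma.fst h
  have h2 : (x : Fin (m i) → A) = y := eq_of_heq (Sigma.mk.inj h).2
  congr 1
  exact DFunLike.coe_injective h2

/-- The lexicographic order on basis elements. -/
noncomputable instance [LinearOrder ι] {A : Type} [LinearOrder A] :
    LinearOrder (FreeBasis m A) :=
  LinearOrder.lift' toLexSigma toLexSigma_injective

theorem map_strictMono [LinearOrder ι] {A B : Type} [LinearOrder A] [LinearOrder B]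
    (f : A ↪o B) :
    StrictMono (map f.toEmbedding : FreeBasis m A → FreeBasis m B) := by
  rintro ⟨i, x⟩ ⟨j, y⟩ h
  replace h : toLexSigma ⟨i, x⟩ < toLexSigma ⟨j, y⟩ := h
  change toLexSigma (map f.toEmbedding ⟨i, x⟩) < toLexSigma (map f.toEmbedding ⟨j, y⟩)
  rw [Sigma.Lex.lt_def] at h ⊢
  rcases h with h | ⟨h, h2⟩
  · exact Or.inl h
  · obtain rfl : i = j := h
    obtain ⟨a, ha, ha'⟩ := h2
    exact Or.inr ⟨rfl, a, fun b hb => congrArg f (ha b hb), f.strictMono ha'⟩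

/-- The word, over a finite alphabet, encoding a basis element at `Fin n`. -/
def word {n : ℕ} (x : FreeBasis m (Fin n)) : List (Set (Σ i : ι, Fin (m i))) :=
  List.ofFn fun b => {a | ∃ h : x.1 = a.1, x.2 (h ▸ a.2) = b}

/-- The letter at position b records the fibre of the injection over b, so an embedding of words
carries the position of each a in `x` to its position in `y`. The component is compared separately
because all letters are empty when `m i = 0`. -/
theorem exists_map_eq_of_word_sublist {n n' : ℕ} {x : FreeBasis m (Fin n)}
    {y : FreeBasis m (Fin n')} (hi : x.1 = y.1) (h : x.word.Sublist y.word) :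
    ∃ f : Fin n ↪o Fin n', map f.toEmbedding x = y := by
  obtain ⟨i, x⟩ := x
  obtain ⟨j, y⟩ := y
  obtain rfl : i = j := hi
  obtain ⟨g, hg⟩ := List.sublist_iff_exists_fin_orderEmbedding_get_eq.1 h
  have h1 : n = (word (m := m) ⟨i, x⟩).length := by simp [word]
  have h2 : (word (m := m) ⟨i, y⟩).length = n' := by simp [word]
  refine ⟨((Fin.castOrderIso h1).toOrderEmbedding.trans g).trans
    (Fin.castOrderIso h2).toOrderEmbedding, ?_⟩
  refine congrArg (Sigma.mk i) (Function.Embedding.ext fun a => ?_)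
  have h3 := hg (Fin.cast h1 (x a))
  simp only [word, List.get_ofFn] at h3
  have h4 := (Set.ext_iff.1 h3 ⟨i, a⟩).1 ⟨rfl, by ext; rfl⟩
  obtain ⟨_, h5⟩ := h4
  exact h5.symm

/-- Any sequence of basis elements has a subsequence in which each element divides the
later ones. -/
theorem exists_subseq_map_eq [Finite ι] (s : ℕ → Σ n : ℕ, FreeBasis m (Fin n)) :
    ∃ g : ℕ ↪o ℕ, ∀ a b, a ≤ b →
      ∃ f : Fin (s (g a)).1 ↪o Fin (s (g b)).1, map f.toEmbedding (s (g a)).2 = (s (g b)).2 := by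
  have : IsPreorder (List (Set (Σ i : ι, Fin (m i)))) List.Sublist :=
    { refl := List.Sublist.refl, trans := fun _ _ _ => List.Sublist.trans }
  obtain ⟨g₁, h₁⟩ := (Finite.wellQuasiOrdered (α := ι) (· = ·)).exists_monotone_subseq
    fun n => (s n).2.1
  obtain ⟨g₂, h₂⟩ := (List.wellQuasiOrdered_sublist (Set (Σ i : ι, Fin (m i)))).exists_monotone_subseq
    fun n => (s (g₁ n)).2.word
  exact ⟨g₂.trans g₁, fun a b hab => exists_map_eq_of_word_sublist
    (h₁ _ _ (g₂.monotone hab)) (h₂ a b hab)⟩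

/-! ### Leading coefficients and generation in bounded degree -/

variable {R : Type u} [Ring R]

/-- The map of free modules induced by an injection. -/
noncomputable abbrev linearMap (R : Type u) [Ring R] {A B : Type} (f : A ↪ B) :
    (FreeBasis m A →₀ R) →ₗ[R] (FreeBasis m B →₀ R) :=
  Finsupp.lmapDomain R R (map f)

/-- The left ideal of leading coefficients, at the basis element `x`, of the elements of a
submodule. -/
noncomputable def leadingIdeal [LinearOrder ι] {A : Type} [LinearOrder A]
    (W : Submodule R (FreeBasis m A →₀ R)) (x : FreeBasis m A) : Submodule R R :=
  (W ⊓ Finsupp.supported R R (Set.Iic x)).map (Finsupp.lapply x)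

theorem linearMap_mem_supported [LinearOrder ι] {A B : Type} [LinearOrder A] [LinearOrder B]
    (f : A ↪o B) {x : FreeBasis m A} {p : FreeBasis m A →₀ R}
    (hp : p ∈ Finsupp.supported R R (Set.Iic x)) :
    linearMap R f.toEmbedding p ∈ Finsupp.supported R R (Set.Iic (map f.toEmbedding x)) := by
  classical
  intro y hy
  obtain ⟨z, hz, rfl⟩ := Finset.mem_image.1 (Finsupp.mapDomain_support hy)
  exact (map_strictMono f).monotone (hp hz)

variable [LinearOrder ι] {W : ∀ n : ℕ, Submodule R (FreeBasis m (Fin n) →₀ R)}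

/-- An increasing injection moves the leading term to the leading term and keeps its coefficient. -/
theorem leadingIdeal_le
    (hW : ∀ (a b : ℕ) (f : Fin a ↪o Fin b), ∀ p ∈ W a, linearMap R f.toEmbedding p ∈ W b)
    {a b : ℕ} (f : Fin a ↪o Fin b) (x : FreeBasis m (Fin a)) :
    leadingIdeal (W a) x ≤ leadingIdeal (W b) (map f.toEmbedding x) := by
  rintro r ⟨p, ⟨hp, hp'⟩, rfl⟩
  exact ⟨linearMap R f.toEmbedding p, ⟨hW _ _ f p hp, linearMap_mem_supported f hp'⟩,
    Finsupp.mapDomain_apply (map_injective _) p x⟩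

variable [Finite ι] [IsNoetherianRing R]

/-- Call `x` minimal if its leading ideal is not attained at a divisor of smaller degree. Minimal
elements of unbounded degree would contain a divisibility chain whose leading ideals stabilize,
against minimality. Descent then takes any `x` to a minimal divisor. -/
theorem exists_leadingIdeal_eq
    (hW : ∀ (a b : ℕ) (f : Fin a ↪o Fin b), ∀ p ∈ W a, linearMap R f.toEmbedding p ∈ W b) :
    ∃ N : ℕ, ∀ (n : ℕ) (x : FreeBasis m (Fin n)), ∃ k ≤ N, ∃ (f : Fin k ↪o Fin n)
      (y : FreeBasis m (Fin k)), map f.toEmbedding y = x ∧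
        leadingIdeal (W k) y = leadingIdeal (W n) x := by
  have key : ∃ N : ℕ, ∀ (n : ℕ) (x : FreeBasis m (Fin n)),
      (∀ (k : ℕ) (f : Fin k ↪o Fin n) (y : FreeBasis m (Fin k)), map f.toEmbedding y = x →
        leadingIdeal (W k) y = leadingIdeal (W n) x → n ≤ k) → n ≤ N := by
    by_contra! hN
    choose d x hx hd using hN
    obtain ⟨g, hg⟩ := exists_subseq_map_eq fun N => ⟨d N, x N⟩
    let I : ℕ →o Submodule R R :=
      ⟨fun a => leadingIdeal (W (d (g a))) (x (g a)), fun a b hab => by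
        obtain ⟨f, hf⟩ := hg a b hab
        exact (leadingIdeal_le hW f _).trans_eq (congrArg _ hf)⟩
    obtain ⟨a, ha⟩ := monotone_stabilizes_iff_noetherian.2 ‹IsNoetherianRing R› I
    -- This index is past stabilization and, since `d N > N`, its degree exceeds `d (g a)`.
    obtain ⟨f, hf⟩ := hg a (max a (d (g a))) (le_max_left _ _)
    have h1 := hx _ _ f _ hf (ha _ (le_max_left _ _))
    have h2 := hd (g (max a (d (g a))))
    have h3 : max a (d (g a)) ≤ g (max a (d (g a))) := g.strictMono.le_apply
    have h4 := le_max_right a (d (g a))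
    exact absurd (h4.trans_lt (h3.trans_lt h2)) h1.not_gt
  obtain ⟨N, hN⟩ := key
  refine ⟨N, fun n => ?_⟩
  induction n using Nat.strong_induction_on with
  | _ n ih =>
    intro x
    by_cases hx : ∀ (k : ℕ) (f : Fin k ↪o Fin n) (y : FreeBasis m (Fin k)),
        map f.toEmbedding y = x → leadingIdeal (W k) y = leadingIdeal (W n) x → n ≤ k
    · exact ⟨n, hN n x hx, RelEmbedding.refl _, x, rfl, rfl⟩
    · push Not at hx
      obtain ⟨k, f, y, hy, hI, hk⟩ := hx
      obtain ⟨l, hl, f', z, hz, hI'⟩ := ih k hk y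
      exact ⟨l, hl, f'.trans f, z, by rw [← hy, ← hz]; rfl, hI'.trans hI⟩

/-- A submodule of a finitely generated free FI-module over a left Noetherian ring is generated
in bounded degree. -/
theorem exists_generated_le
    (hW : ∀ (a b : ℕ) (f : Fin a ↪o Fin b), ∀ p ∈ W a, linearMap R f.toEmbedding p ∈ W b) :
    ∃ N : ℕ, ∀ (n : ℕ) (Q : Submodule R (FreeBasis m (Fin n) →₀ R)),
      (∀ k ≤ N, ∀ (f : Fin k ↪o Fin n), ∀ p ∈ W k, linearMap R f.toEmbedding p ∈ Q) →
        W n ≤ Q := by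
  obtain ⟨N, hN⟩ := exists_leadingIdeal_eq hW
  refine ⟨N, fun n Q hQ => ?_⟩
  have key : ∀ x : FreeBasis m (Fin n), ∀ p ∈ W n,
      p ∈ Finsupp.supported R R (Set.Iic x) → p ∈ Q := by
    intro x
    induction x using WellFoundedLT.induction with
    | _ x ih =>
      intro p hp hpx
      obtain ⟨k, hk, f, y, rfl, hI⟩ := hN n x
      have hr : p (map f.toEmbedding y) ∈ leadingIdeal (W n) (map f.toEmbedding y) :=
        ⟨p, ⟨hp, hpx⟩, rfl⟩
      rw [← hI] at hr
      obtain ⟨q, ⟨hq, hqy⟩, hqr⟩ := hr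
      have hqQ := hQ k hk f q hq
      have hqs := linearMap_mem_supported f hqy
      have hqv : linearMap R f.toEmbedding q (map f.toEmbedding y) = p (map f.toEmbedding y) :=
        (Finsupp.mapDomain_apply (map_injective _) q y).trans hqr
      -- Division step: subtracting an element of `Q` with the same leading coefficient leaves a
      -- strictly smaller leading term, or zero.
      rw [← sub_add_cancel p (linearMap R f.toEmbedding q)]
      refine Q.add_mem ?_ hqQ
      generalize hp'' : p - linearMap R f.toEmbedding q = p'
      have hp' : p' ∈ W n := hp'' ▸ (W n).sub_mem hp (hW _ _ f q hq)
      have hs : p' ∈ Finsupp.supported R R (Set.Iic (map f.toEmbedding y)) :=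
        hp'' ▸ Submodule.sub_mem _ hpx hqs
      have hz : p' (map f.toEmbedding y) = 0 := by
        rw [← hp'', Finsupp.sub_apply, hqv, sub_self]
      rcases eq_or_ne p' 0 with h0 | h0
      · rw [h0]; exact Q.zero_mem
      · have hne : p'.support.Nonempty := Finsupp.support_nonempty_iff.2 h0
        have hmem := p'.support.max'_mem hne
        refine ih _ (lt_of_le_of_ne (hs hmem) fun h => ?_) p' hp' fun z hz =>
          p'.support.le_max' z hz
        rw [h] at hmem
        exact Finsupp.mem_support_iff.1 hmem hz
  intro p hp
  rcases eq_or_ne p 0 with h0 | h0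
  · rw [h0]; exact Q.zero_mem
  · exact key (p.support.max' (Finsupp.support_nonempty_iff.2 h0)) p hp fun z hz =>
      p.support.le_max' z hz

end FreeBasis

/-! ### Free covers of `V` -/

namespace FI

/-- The image of an injection from a set with at most `N` elements. -/
def smallImage {k n N : ℕ} (hk : k ≤ N) (f : std k ⟶ std n) : SmallSubset n N :=
  ⟨Finset.univ.map f, by rw [Finset.card_map, Finset.card_univ, Fintype.card_fin]; exact hk⟩

/-- An injection into `{1, …, n}`, with codomain restricted to its image. -/
def toImage {k n N : ℕ} (hk : k ≤ N) (f : std k ⟶ std n) :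
    std k ⟶ ofFinset (smallImage hk f).1 :=
  (⟨fun a => ⟨f.toFun a, Finset.mem_map_of_mem f (Finset.mem_univ a)⟩,
    fun _ _ h => f.injective (congrArg Subtype.val h)⟩ :
    Fin k ↪ {a : Fin n // a ∈ (smallImage hk f).1})

end FI

namespace FIModule

variable {R : Type u} [Ring R] (V : FIModule.{u, v} R) {ι : Type} {m : ι → ℕ}
  (x : ∀ i, V.obj (FI.std (m i)))

/-- The map to `V` from the free FI-module on the elements `x i`. -/
noncomputable def cover (X : FI) : (FreeBasis m X.carrier →₀ R) →ₗ[R] V.obj X :=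
  Finsupp.linearCombination R fun b => V.map (show FI.std (m b.1) ⟶ X from b.2) (x b.1)

theorem cover_single {X : FI} (b : FreeBasis m X.carrier) (r : R) :
    V.cover x X (Finsupp.single b r) =
      r • V.map (show FI.std (m b.1) ⟶ X from b.2) (x b.1) :=
  Finsupp.linearCombination_single R r b

theorem cover_linearMap {X Y : FI} (f : X ⟶ Y) (p : FreeBasis m X.carrier →₀ R) :
    V.cover x Y (FreeBasis.linearMap R f p) = V.map f (V.cover x X p) := by
  suffices h : V.cover x Y ∘ₗ FreeBasis.linearMap R f = (V.map f).hom ∘ₗ V.cover x X from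
    LinearMap.congr_fun h p
  refine Finsupp.lhom_ext fun b r => ?_
  simp only [LinearMap.comp_apply, Finsupp.lmapDomain_apply, Finsupp.mapDomain_single,
    cover_single, map_smul]
  congr 1
  exact LinearMap.congr_fun (congrArg ModuleCat.Hom.hom
    (V.map_comp (show FI.std (m b.1) ⟶ X from b.2) f)) (x b.1)

/-- The images of the maps from the free FI-module form a sub-FI-module. -/
noncomputable def coverRange : Sub V where
  obj X := LinearMap.range (V.cover x X)
  map_mem := by
    rintro X Y f _ ⟨p, rfl⟩
    exact ⟨_, V.cover_linearMap x f p⟩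

theorem FinitelyGenerated.exists_cover_surjective {V : FIModule.{u, v} R}
    (hV : V.FinitelyGenerated) :
    ∃ (k : ℕ) (m : Fin k → ℕ) (x : ∀ i, V.obj (FI.std (m i))),
      ∀ X : FI, Function.Surjective (V.cover x X) := by
  obtain ⟨s, hs, h⟩ := hV
  have := hs.to_subtype
  obtain ⟨k, ⟨e⟩⟩ := Finite.exists_equiv_fin s
  refine ⟨k, fun i => (e.symm i).1.1, fun i => (e.symm i).1.2, fun X =>
    LinearMap.range_eq_top.1 (h (V.coverRange _) (fun y hy => ?_) X)⟩
  obtain ⟨i, hi⟩ := e.symm.surjective ⟨y, hy⟩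
  obtain rfl : (e.symm i).1 = y := congrArg Subtype.val hi
  refine ⟨Finsupp.single ⟨i, Function.Embedding.refl _⟩ 1, ?_⟩
  rw [cover_single, one_smul]
  exact LinearMap.congr_fun (congrArg ModuleCat.Hom.hom (V.map_id _)) _

/-! ### Comparison of the colimit with `V_n` -/

theorem toColimit_inclusion {n N : ℕ} {S T : SmallSubset n N} (h : S ≤ T)
    (y : V.obj (FI.ofFinset S.1)) :
    V.toColimit T (V.map (FI.inclusion h) y) = V.toColimit S y :=
  LinearMap.congr_fun (congrArg ModuleCat.Hom.hom
    (colimit.w (V.diagram n N) (homOfLE h))) y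

/-- The natural map from the colimit to `V_n`. -/
noncomputable def fromColimit (n N : ℕ) : V.smallColimit n N ⟶ V.obj (FI.std n) :=
  colimit.desc (V.diagram n N)
    { pt := V.obj (FI.std n)
      ι :=
        { app := fun S => V.map (FI.incl S.1)
          naturality := fun _ T f =>
            ((V.map_comp (FI.inclusion (leOfHom f)) (FI.incl T.1)).symm.trans
              (Category.comp_id _).symm) } }

theorem toColimit_fromColimit {n N : ℕ} (S : SmallSubset n N) :
    V.toColimit S ≫ V.fromColimit n N = V.map (FI.incl S.1) :=
  colimit.ι_desc _ S

theorem fromColimit_toColimit {n N : ℕ} (S : SmallSubset n N) (y : V.obj (FI.ofFinset S.1)) :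
    V.fromColimit n N (V.toColimit S y) = V.map (FI.incl S.1) y :=
  LinearMap.congr_fun (congrArg ModuleCat.Hom.hom (V.toColimit_fromColimit S)) y

theorem fromColimit_permColimit {n N : ℕ} (σ : Equiv.Perm (Fin n)) (z : V.smallColimit n N) :
    V.fromColimit n N (V.permColimit n N σ z) = V.perm n σ (V.fromColimit n N z) := by
  suffices h : V.permColimitHom n N σ ≫ V.fromColimit n N =
      V.fromColimit n N ≫ V.map (FI.ofPerm σ) from
    LinearMap.congr_fun (congrArg ModuleCat.Hom.hom h) z
  refine colimit.hom_ext fun S => ?_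
  change V.toColimit S ≫ _ = V.toColimit S ≫ _
  rw [← Category.assoc, V.toColimit_permColimitHom, Category.assoc, V.toColimit_fromColimit,
    ← Category.assoc, V.toColimit_fromColimit, ← V.map_comp, ← V.map_comp]
  rfl

/-- The lift to the colimit of the map to `V_n` from the free FI-module on elements of degree at
most `N`. -/
noncomputable def colimitCover {N : ℕ} (hm : ∀ i, m i ≤ N) (n : ℕ) :
    (FreeBasis m (Fin n) →₀ R) →ₗ[R] V.smallColimit n N :=
  Finsupp.linearCombination R fun b =>
    V.toColimit (FI.smallImage (hm b.1) b.2) (V.map (FI.toImage (hm b.1) b.2) (x b.1))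

theorem colimitCover_linearMap_incl {N : ℕ} (hm : ∀ i, m i ≤ N) {n : ℕ} (S : SmallSubset n N)
    (p : FreeBasis m (FI.ofFinset S.1).carrier →₀ R) :
    V.colimitCover x hm n (FreeBasis.linearMap R (FI.incl S.1) p) =
      V.toColimit S (V.cover x (FI.ofFinset S.1) p) := by
  suffices h : V.colimitCover x hm n ∘ₗ FreeBasis.linearMap R (FI.incl S.1) =
      (V.toColimit S).hom ∘ₗ V.cover x (FI.ofFinset S.1) from LinearMap.congr_fun h p
  refine Finsupp.lhom_ext fun b r => ?_
  simp only [LinearMap.comp_apply, Finsupp.lmapDomain_apply, Finsupp.mapDomain_single,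
    cover_single, map_smul, colimitCover, Finsupp.linearCombination_single]
  congr 1
  have hle : FI.smallImage (hm b.1) (FreeBasis.map (FI.incl S.1) b).2 ≤ S := by
    intro a ha
    obtain ⟨c, -, rfl⟩ := Finset.mem_map.1 ha
    exact (b.2 c).2
  -- The image of `b` may be smaller than `S`; the two structure maps agree in the colimit.
  refine (V.toColimit_inclusion hle _).symm.trans ?_
  refine congrArg (V.toColimit S) ?_
  exact (LinearMap.congr_fun (congrArg ModuleCat.Hom.hom
    (V.map_comp (FI.toImage (hm b.1) (FreeBasis.map (FI.incl S.1) b).2) (FI.inclusion hle))) (x b.1)).symm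

theorem fromColimit_colimitCover {N : ℕ} (hm : ∀ i, m i ≤ N) {n : ℕ}
    (p : FreeBasis m (Fin n) →₀ R) :
    V.fromColimit n N (V.colimitCover x hm n p) = V.cover x (FI.std n) p := by
  suffices h : (V.fromColimit n N).hom ∘ₗ V.colimitCover x hm n = V.cover x (FI.std n) from
    LinearMap.congr_fun h p
  refine Finsupp.lhom_ext fun b r => ?_
  simp only [LinearMap.comp_apply, cover_single, map_smul, colimitCover,
    Finsupp.linearCombination_single]
  congr 1
  refine (V.fromColimit_toColimit _ _).trans ?_
  exact (LinearMap.congr_fun (congrArg ModuleCat.Hom.hom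
    (V.map_comp (FI.toImage (hm b.1) b.2) (FI.incl _))) (x b.1)).symm

theorem colimitCover_surjective (hx : ∀ X : FI, Function.Surjective (V.cover x X)) {N : ℕ}
    (hm : ∀ i, m i ≤ N) (n : ℕ) : Function.Surjective (V.colimitCover x hm n) := by
  rw [← LinearMap.range_eq_top]
  -- The cokernel projection can be tested on each `V(S)`, whose elements all lift to the free
  -- module on `S`.
  suffices h : ModuleCat.ofHom (LinearMap.range (V.colimitCover x hm n)).mkQ = 0 by
    rw [← Submodule.ker_mkQ (LinearMap.range (V.colimitCover x hm n))]
    exact LinearMap.ker_eq_top.2 (congrArg ModuleCat.Hom.hom h)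
  refine colimit.hom_ext fun S => ModuleCat.hom_ext (LinearMap.ext fun y => ?_)
  obtain ⟨p, rfl⟩ := hx (FI.ofFinset S.1) y
  refine (Submodule.Quotient.mk_eq_zero _).2 ⟨_, V.colimitCover_linearMap_incl x hm S p⟩

theorem ker_cover_le_ker_colimitCover [LinearOrder ι] [Finite ι] [IsNoetherianRing R] :
    ∃ N₀ : ℕ, ∀ (N : ℕ) (hm : ∀ i, m i ≤ N), N₀ ≤ N → ∀ n : ℕ,
      LinearMap.ker (V.cover x (FI.std n)) ≤ LinearMap.ker (V.colimitCover x hm n) := by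
  obtain ⟨N₀, h⟩ := FreeBasis.exists_generated_le
    (W := fun n => LinearMap.ker (V.cover x (FI.std n))) (fun a b f p hp => by
      rw [LinearMap.mem_ker] at hp ⊢
      refine (V.cover_linearMap x (X := FI.std a) (Y := FI.std b) f.toEmbedding p).trans ?_
      rw [hp, map_zero])
  refine ⟨N₀, fun N hm hN n => h n _ fun k hk f p hp => ?_⟩
  rw [LinearMap.mem_ker] at hp ⊢
  let g : FI.std k ⟶ FI.std n := f.toEmbedding
  -- Factoring through the image of `f` turns `p` into a relation over a subset with at most `N`
  -- elements, which vanishes before passing to the colimit.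
  have h1 : FreeBasis.linearMap R f.toEmbedding p =
      FreeBasis.linearMap R (FI.incl (FI.smallImage (hk.trans hN) g).1)
        (FreeBasis.linearMap R (FI.toImage (hk.trans hN) g) p) := by
    exact Finsupp.mapDomain_comp (f := FreeBasis.map (FI.toImage (hk.trans hN) g))
      (g := FreeBasis.map (FI.incl (FI.smallImage (hk.trans hN) g).1))
  rw [h1, V.colimitCover_linearMap_incl x hm]
  refine (congrArg _ (V.cover_linearMap x (FI.toImage (hk.trans hN) g) p)).trans ?_
  rw [hp, map_zero, map_zero]

end FIModule

theorem theorem6p2 {R : Type u} [Ring R] [IsNoetherianRing R] (V : FIModule.{u, v} R)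
    (hV : V.FinitelyGenerated) :
    ∃ N : ℕ, ∀ n : ℕ, ∃ e : V.smallColimit n N ≃ₗ[R] V.obj (FI.std n),
      (∀ (S : SmallSubset n N) (x : V.obj (FI.ofFinset S.1)),
        e (V.toColimit S x) = V.map (FI.incl S.1) x) ∧
      ∀ (σ : Equiv.Perm (Fin n)) (x : V.smallColimit n N),
        e (V.permColimit n N σ x) = V.perm n σ (e x) := by
  obtain ⟨k, m, x, hx⟩ := hV.exists_cover_surjective
  obtain ⟨N₀, hN₀⟩ := V.ker_cover_le_ker_colimitCover x
  obtain ⟨N, hN, hm⟩ : ∃ N, N₀ ≤ N ∧ ∀ i, m i ≤ N :=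
    ⟨max N₀ (Finset.univ.sup m), le_max_left _ _, fun i =>
      (Finset.le_sup (Finset.mem_univ i)).trans (le_max_right _ _)⟩
  refine ⟨N, fun n => ⟨LinearEquiv.ofBijective (V.fromColimit n N).hom ⟨?_, ?_⟩,
    V.fromColimit_toColimit, V.fromColimit_permColimit⟩⟩
  · refine (injective_iff_map_eq_zero _).2 fun z hz => ?_
    obtain ⟨p, rfl⟩ := V.colimitCover_surjective x hx hm n z
    exact hN₀ N hm hN n ((V.fromColimit_colimitCover x hm p).symm.trans hz)
  · intro y
    obtain ⟨p, rfl⟩ := hx (FI.std n) y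
    exact ⟨_, V.fromColimit_colimitCover x hm p⟩
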